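/- All bidirected graphs are finite; loops and parallel edges are allowed, each of the two ends of an edge carries a sign from $\{+,-\}$, and vertices are taken from a fixed infinite set of symbols. A ditrail from $x$ to $y$ is a walk $(x=v_0,e_1,v_1,\dots,e_k,v_k=y)$ with pairwise distinct edges (vertices may repeat) such that for $0<i<k$ the signs at $v_i$ of the arriving edge $e_i$ and the leaving edge $e_{i+1}$ are opposite. For $k\ge 1$ it is an $(\alpha,\beta)$-ditrail if $\alpha$ is the sign of $x$ over $e_1$ and $\beta$ the sign of $y$ over $e_k$; the trivial ditrail ($k=0$) is an $(\alpha,-\alpha)$-ditrail for each sign $\alpha$. An $\alpha$-ditrail is an $(\alpha,\beta)$-ditrail for some sign $\beta$. Let $\alpha\in\{+,-\}$, let $G$ be a bidirected graph and let $r\in V(G)$. - $G$ is an $\alpha$-radial (resp. $\alpha$-semiradial) with root $r$ if every vertex has an $(\alpha,-\alpha)$-ditrail (resp. an $\alpha$-ditrail) to $r$. - An $\alpha$-radial $G$ with root $r$ is almost strong if every vertex $v\neq r$ has a $(-\alpha,-\alpha)$-ditrail to $r$ but there is no $(-\alpha,-\alpha)$-ditrail from $r$ to $r$. - An $\alpha$-semiradial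 $G$ with root $r$ is linear if there is no loop over $r$ and the trivial ditrail at $r$ is the only $-\alpha$-ditrail ending at $r$. - An $\alpha$-radial $G$ with root $r$ is round if there is no $(-\alpha,-\alpha)$-ditrail from $r$ to $r$, and every vertex $v\neq r$ joined with $r$ by an edge over which $r$ has sign $-\alpha$ has both an $(\alpha,-\alpha)$-ditrail and a $(-\alpha,-\alpha)$-ditrail to $r$. - An $\alpha$-semiradial $G$ with root $r$ is sharp if there is no loop over $r$ and no neighbor of $r$ has a $-\alpha$-ditrail to $r$. Let $G,H$ be disjoint bidirected graphs, $s\in V(G)$, $T\subseteq V(H)$, and let $F$ be the set of edges of $G$ incident with $s$ (loops over $s$ included). A bidirected graph $K$ is a gluing sum $(G;s)\oplus(H;T)$ if $V(K)=(V(G)\setminus\{s\})\cup V(H)$, the edges in $(E(G)\setminus F)\cup E(H)$ are edges of $K$ with the same ends and signs, and there is a bijection $f$ from $F$ onto the remaining edges of $K$ such that: if $e\in F$ joins $s$ and $v\ne s$, then $f(e)$ joins some $t\in T$ and $v$, where $t$ and $v$ have over $f(e)$ the signs of $s$ and $v$ over $e$; and if $e\in F$ is a loop over $s$ with signs $\alpha_1,\alpha_2$,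 then $f(e)$ is an $(\alpha_1,\alpha_2)$-edge between two (possibly identical) vertices of $T$. For all vertex symbols $r$, the sets $\mathcal R_r^\alpha$ and $\mathcal S_r^\alpha$ of bidirected graphs are defined simultaneously as the smallest ones satisfying the following. 1. Every almost strong $\alpha$-radial with root $r$ is in $\mathcal R_r^\alpha$. 2. Every linear $\alpha$-semiradial with root $r$ is in $\mathcal S_r^\alpha$. 3. If $G\in\mathcal R_r^\alpha$, then every bidirected graph obtained from $G$ by adding some edges $rv$ with $v\in V(G)$ (possibly $v=r$), over which $r$ has sign $\alpha$ (for a loop: one of its two ends has sign $\alpha$), is in $\mathcal R_r^\alpha$. 4. If $G\in\mathcal S_s^\alpha$ and $H$ is an almost strong $\alpha$-radial with root $r$ disjoint from $G$, then every gluing sum $(G;s)\oplus(H;V(H)\setminus\{r\})$ is in $\mathcal R_r^\alpha$. 5. If $G\in\mathcal R_s^\alpha$ and $H$ is a linear $\alpha$-semiradial with root $r$ disjoint from $G$, then every gluing sum $(G;s)\oplus(H;V(H)\setminus\{r\})$ is in $\mathcal S_r^\alpha$. Theorem. For every sign $\alpha$, every vertex symbol $r$ and every bidirected graph $G$: $G\in\mathcal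 R_r^\alpha$ if and only if $G$ is a round $\alpha$-radial with root $r$; and $G\in\mathcal S_r^\alpha$ if and only if $G$ is a sharp $\alpha$-semiradial with root $r$. -/

import Mathlib

/-- The set `{+, -}` of signs, realized as the units `{1, -1}` of `ℤ`. -/
abbrev Sign : Type := ℤˣ

/-- A finite bidirected graph whose vertices and edges are taken from the symbol types `V` and `E`.
Every edge has two ends, each carrying a sign; loops and parallel edges are allowed. The edge `e`
joining `u`, with sign `a`, and `v`, with sign `b`, has `ends e = s((u, a), (v, b))`.
The value of `ends` outside `edgeSet` is irrelevant. -/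
structure BidirectedGraph (V E : Type*) where
  vertexSet : Set V
  edgeSet : Set E
  ends : E → Sym2 (V × Sign)
  finite_vertexSet : vertexSet.Finite
  finite_edgeSet : edgeSet.Finite
  ends_mem : ∀ e ∈ edgeSet, ∀ p ∈ ends e, p.1 ∈ vertexSet

namespace BidirectedGraph

variable {V E : Type*}

/-- `G.IsDitrail es x a y b`: there is an `(a, b)`-ditrail of `G` from `x` to `y` whose sequence of
edges is `es`. No edge is repeated, and at each inner vertex of the sequence the arriving and the
leaving edge have opposite signs there; `a` is the sign of `x` over the first edge and `b` is the
sign of `y` over the last edge. The trivial ditrail, with no edge, is an `(a, -a)`-ditrail for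
each sign `a`. -/
inductive IsDitrail (G : BidirectedGraph V E) : List E → V → Sign → V → Sign → Prop
  | nil (x : V) (a : Sign) (hx : x ∈ G.vertexSet) : IsDitrail G [] x a x (-a)
  | cons (e : E) (es : List E) (x z y : V) (a c b : Sign)
      (he : e ∈ G.edgeSet) (hends : G.ends e = s((x, a), (z, c)))
      (htail : IsDitrail G es z (-c) y b) (hnew : e ∉ es) :
      IsDitrail G (e :: es) x a y b

/-- The vertices from which there is an `(a, b)`-ditrail to `r`. -/
def reach (G : BidirectedGraph V E) (r : V) (a b : Sign) : Set V :=
  {x | ∃ es, G.IsDitrail es x a r b}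

/-- The vertices from which there is an `a`-ditrail to `r`, i.e. an `(a, b)`-ditrail for
some sign `b`. -/
def reachAny (G : BidirectedGraph V E) (r : V) (a : Sign) : Set V :=
  {x | ∃ b, x ∈ G.reach r a b}

/-- `x` is `α`-linear with respect to `r`. -/
def IsLinearVertex (G : BidirectedGraph V E) (α : Sign) (r x : V) : Prop :=
  x ∈ G.reachAny r α \ G.reachAny r (-α)

/-- `x` is `α`-strong with respect to `r`. -/
def IsStrongVertex (G : BidirectedGraph V E) (α : Sign) (r x : V) : Prop :=
  x ∈ G.reach r α (-α) ∩ G.reach r (-α) (-α)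

/-- `x` is `α`-sublinear with respect to `r`. -/
def IsSublinearVertex (G : BidirectedGraph V E) (α : Sign) (r x : V) : Prop :=
  x ∈ G.reach r α (-α) \ G.reach r (-α) (-α)

/-- The vertices outside `S` joined with a vertex of `S` by an edge whose end in `S` has
sign `a`. -/
def signedNeighbors (G : BidirectedGraph V E) (S : Set V) (a : Sign) : Set V :=
  {v | v ∉ S ∧ ∃ e ∈ G.edgeSet, ∃ u ∈ S, ∃ b, G.ends e = s((u, a), (v, b))}

/-- The vertices outside `S` adjacent to a vertex of `S`. -/
def neighbors (G : BidirectedGraph V E) (S : Set V) : Set V :=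
  {v | ∃ a, v ∈ G.signedNeighbors S a}

/-- The loops over the vertex `r`. -/
def loopsAt (G : BidirectedGraph V E) (r : V) : Set E :=
  {e ∈ G.edgeSet | ∃ a b, G.ends e = s((r, a), (r, b))}

/-- The edges having `r` as an end: the cut edges of `{r}` together with the loops over `r`. -/
def edgesAt (G : BidirectedGraph V E) (r : V) : Set E :=
  {e ∈ G.edgeSet | ∃ v a b, G.ends e = s((r, a), (v, b))}

/-- `G` is an `α`-radial with root `r`. -/
def IsRadial (G : BidirectedGraph V E) (α : Sign) (r : V) : Prop :=
  r ∈ G.vertexSet ∧ ∀ v ∈ G.vertexSet, v ∈ G.reach r α (-α)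

/-- `G` is an `α`-semiradial with root `r`. -/
def IsSemiradial (G : BidirectedGraph V E) (α : Sign) (r : V) : Prop :=
  r ∈ G.vertexSet ∧ ∀ v ∈ G.vertexSet, v ∈ G.reachAny r α

/-- `G` is an almost strong `α`-radial with root `r`. -/
def IsAlmostStrongRadial (G : BidirectedGraph V E) (α : Sign) (r : V) : Prop :=
  G.IsRadial α r ∧ (∀ v ∈ G.vertexSet, v ≠ r → v ∈ G.reach r (-α) (-α)) ∧
    r ∉ G.reach r (-α) (-α)

/-- `G` is a linear `α`-semiradial with root `r`: there is no loop over `r`, and the trivial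
ditrail at `r` is the only `-α`-ditrail ending at `r`. -/
def IsLinearSemiradial (G : BidirectedGraph V E) (α : Sign) (r : V) : Prop :=
  G.IsSemiradial α r ∧ G.loopsAt r = ∅ ∧
    ∀ es x b, G.IsDitrail es x (-α) r b → es = []

/-- `G` is a round `α`-radial with root `r`: the root is sublinear, and every vertex joined
with `r` by a nonloop edge over which `r` has sign `-α` is strong. -/
def IsRoundRadial (G : BidirectedGraph V E) (α : Sign) (r : V) : Prop :=
  G.IsRadial α r ∧ G.IsSublinearVertex α r r ∧
    ∀ v ∈ G.signedNeighbors {r} (-α), G.IsStrongVertex α r v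

/-- `G` is a sharp `α`-semiradial with root `r`: every neighbor of `r` is linear. A loop over `r`
would make `r`, which is never linear, a neighbor of itself, so there is no such loop
(equivalently, the only subgraph of `G` that is an absolute semiradial with root `r` is the
single vertex `r` with no edge). -/
def IsSharpSemiradial (G : BidirectedGraph V E) (α : Sign) (r : V) : Prop :=
  G.IsSemiradial α r ∧ G.loopsAt r = ∅ ∧
    ∀ v ∈ G.neighbors {r}, G.IsLinearVertex α r v

/-- `K` is a gluing sum `(G; s) ⊕ (H; T)` of the disjoint bidirected graphs `G` and `H`: the ends
at `s` of the edges of `G` are redistributed over vertices of `T`, with all signs kept, and the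
other edges of `G` and those of `H` stay as they are. The map `f` records which edge of `K` an
edge of `G` at `s` turns into. -/
structure IsGluingSum (G : BidirectedGraph V E) (s : V) (H : BidirectedGraph V E) (T : Set V)
    (K : BidirectedGraph V E) : Prop where
  root_mem : s ∈ G.vertexSet
  subset : T ⊆ H.vertexSet
  disjoint_vertexSet : Disjoint G.vertexSet H.vertexSet
  disjoint_edgeSet : Disjoint G.edgeSet H.edgeSet
  vertexSet_eq : K.vertexSet = (G.vertexSet \ {s}) ∪ H.vertexSet
  left_edge : ∀ e ∈ G.edgeSet \ G.edgesAt s, e ∈ K.edgeSet ∧ K.ends e = G.ends e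
  right_edge : ∀ e ∈ H.edgeSet, e ∈ K.edgeSet ∧ K.ends e = H.ends e
  glued_edge : ∃ f : E → E,
    Set.BijOn f (G.edgesAt s) ((K.edgeSet \ (G.edgeSet \ G.edgesAt s)) \ H.edgeSet) ∧
    (∀ e ∈ G.edgesAt s, ∀ a v b, v ≠ s → G.ends e = s((s, a), (v, b)) →
      ∃ t ∈ T, K.ends (f e) = s((t, a), (v, b))) ∧
    (∀ e ∈ G.edgesAt s, ∀ a b, G.ends e = s((s, a), (s, b)) →
      ∃ t ∈ T, ∃ t' ∈ T, K.ends (f e) = s((t, a), (t', b)))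

/-- `K` is obtained from `G` by adding some edges between `r` and vertices of `G` over which `r`
has sign `α`. -/
structure IsRootEdgeExtension (α : Sign) (r : V) (G K : BidirectedGraph V E) : Prop where
  vertexSet_eq : K.vertexSet = G.vertexSet
  old_edge : ∀ e ∈ G.edgeSet, e ∈ K.edgeSet ∧ K.ends e = G.ends e
  new_edge : ∀ e ∈ K.edgeSet \ G.edgeSet,
    ∃ v ∈ G.vertexSet, ∃ b, K.ends e = s((r, α), (v, b))

mutual

/-- The inductively defined family of bidirected graphs for round `α`-radials with root `r`. -/
inductive RoundFamily (α : Sign) : V → BidirectedGraph V E → Prop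
  | base (r : V) (G : BidirectedGraph V E) (hG : G.IsAlmostStrongRadial α r) :
      RoundFamily α r G
  | addEdges (r : V) (G K : BidirectedGraph V E) (hG : RoundFamily α r G)
      (hK : IsRootEdgeExtension α r G K) : RoundFamily α r K
  | glue (r s : V) (G H K : BidirectedGraph V E) (hG : SharpFamily α s G)
      (hH : H.IsAlmostStrongRadial α r) (hK : IsGluingSum G s H (H.vertexSet \ {r}) K) :
      RoundFamily α r K

/-- The companion family for sharp `α`-semiradials with root `r`. -/
inductive SharpFamily (α : Sign) : V → BidirectedGraph V E → Prop
  | base (r : V) (G : BidirectedGraph V E) (hG : G.IsLinearSemiradial α r) :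
      SharpFamily α r G
  | glue (r s : V) (G H K : BidirectedGraph V E) (hG : RoundFamily α s G)
      (hH : H.IsLinearSemiradial α r) (hK : IsGluingSum G s H (H.vertexSet \ {r}) K) :
      SharpFamily α r K

end

end BidirectedGraph

namespace BidirectedGraph

variable {V E : Type*}

-- A gluing sum is the inverse of a contraction: collapsing `H` in `K` to `s` gives back `G`.
-- Ditrails of `K` can be projected to `G` up to their next entry into `H`, and ditrails of `G` can
-- be lifted to `K` up to their first visit of `s` (`IsContraction.project`, `IsContraction.lift`).
-- Roundness and sharpness are thereby transferred in both directions.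
--
-- That members of the families are round or sharp follows by structural induction. The root of a
-- sharp semiradial has no nontrivial closed ditrail, and the root of a round radial has no `(-α,
-- -α)`-ditrail to itself; this controls every excursion out of `H` (`IsContraction.isRoundRadial`,
-- `IsContraction.isSharpSemiradial`).
--
-- The converse is by induction on the number of vertices. In a sharp semiradial the largest linear
-- set is contracted, in a round radial (after deleting the edges with sign `α` at the root) the
-- largest strong set. Either set contains all neighbors of the root, so the contracted graph is
-- glued away from the root. Maximality makes the contraction round in the first case
-- (`IsSharpSemiradial.isRoundRadial_contract`) and, through an ear argument
-- (`IsStrongSet.exists_ear`), sharp in the second (`IsRoundRadial.isSharpSemiradial_contract`).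

theorem sign_eq_or_eq_neg (a b : Sign) : a = b ∨ a = -b := by
  by_cases h : a = b
  · exact Or.inl h
  · exact Or.inr (Int.units_ne_iff_eq_neg.1 h)

theorem sign_ne_neg (a : Sign) : a ≠ -a := by
  revert a; decide

-- Cutting, joining and reversing ditrails.

namespace IsDitrail

variable {G K : BidirectedGraph V E} {es l₁ l₂ : List E} {x y z : V} {a b c : Sign}

theorem left_mem (h : G.IsDitrail es x a y b) : x ∈ G.vertexSet := by
  cases h with
  | nil _ _ hx => exact hx
  | cons e es x z y a c b he hends htail hnew => exact G.ends_mem e he (x, a) (by simp [hends])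

theorem right_mem (h : G.IsDitrail es x a y b) : y ∈ G.vertexSet := by
  induction h with
  | nil _ _ hx => exact hx
  | cons _ _ _ _ _ _ _ _ _ _ _ _ ih => exact ih

theorem edge_mem (h : G.IsDitrail es x a y b) : ∀ e ∈ es, e ∈ G.edgeSet := by
  induction h with
  | nil _ _ hx => simp
  | cons e es x z y a c b he hends htail hnew ih => simpa [he] using ih

theorem eq_of_nil (h : G.IsDitrail [] x a y b) : x = y ∧ b = -a := by
  cases h; simp

theorem ne_nil (h : G.IsDitrail es x a y b) (hxy : x ≠ y) : es ≠ [] := by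
  rintro rfl
  exact hxy h.eq_of_nil.1

theorem single {e : E} (he : e ∈ G.edgeSet) (hends : G.ends e = s((x, a), (y, b))) :
    G.IsDitrail [e] x a y b := by
  have hy : y ∈ G.vertexSet := G.ends_mem e he (y, b) (by simp [hends])
  have := IsDitrail.nil (G := G) y (-b) hy
  rw [neg_neg] at this
  exact .cons e [] x y y a b b he hends this (by simp)

theorem append (h₁ : G.IsDitrail l₁ x a z c) (h₂ : G.IsDitrail l₂ z (-c) y b)
    (hd : ∀ e ∈ l₁, e ∉ l₂) : G.IsDitrail (l₁ ++ l₂) x a y b := by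
  induction h₁ with
  | nil _ _ hx => simpa using h₂
  | cons e es x z y a c b he hends htail hnew ih =>
    refine .cons e _ x z _ a c _ he hends (ih h₂ fun e he => hd e (by simp [he])) ?_
    simp [hnew, hd e]

theorem reverse (h : G.IsDitrail es x a y b) : G.IsDitrail es.reverse y b x a := by
  induction h with
  | nil x a hx => simpa using IsDitrail.nil (G := G) x (-a) hx
  | cons e es x z y a c b he hends htail hnew ih =>
    rw [List.reverse_cons]
    refine ih.append ?_ ?_
    · rw [neg_neg]
      exact single he (by rw [hends, Sym2.eq_swap])
    · intro f hf hfe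
      simp only [List.mem_singleton] at hfe
      subst hfe
      exact hnew (by simpa using hf)

theorem mono (h : G.IsDitrail es x a y b) (hx : x ∈ K.vertexSet)
    (hK : ∀ e ∈ es, e ∈ K.edgeSet ∧ K.ends e = G.ends e) : K.IsDitrail es x a y b := by
  induction h with
  | nil x a _ => exact .nil x a hx
  | cons e es x z y a c b he hends htail hnew ih =>
    have h1 := hK e (by simp)
    rw [hends] at h1
    exact .cons e es x z y a c b h1.1 h1.2
      (ih (K.ends_mem e h1.1 (z, c) (by simp [h1.2])) fun e he => hK e (by simp [he])) hnew

/-- A ditrail can be cut at either end of any of its edges. -/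
theorem exists_split (h : G.IsDitrail es x a y b) {e : E} (he : e ∈ es) {p : V × Sign}
    (hp : p ∈ G.ends e) : ∃ l₁ l₂ c, es = l₁ ++ l₂ ∧ G.IsDitrail l₁ x a p.1 c ∧
      G.IsDitrail l₂ p.1 (-c) y b := by
  induction h with
  | nil _ _ hx => simp at he
  | cons f es x z y a c b hf hends htail hnew ih =>
    rcases List.mem_cons.1 he with rfl | he
    · rw [hends, Sym2.mem_iff] at hp
      rcases hp with rfl | rfl
      · refine ⟨[], e :: es, -a, rfl, .nil _ _ (G.ends_mem e hf (x, a) (by simp [hends])), ?_⟩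
        rw [neg_neg]
        exact .cons e es x z y a c b hf hends htail hnew
      · exact ⟨[e], es, c, rfl, single hf hends, htail⟩
    · obtain ⟨l₁, l₂, d, rfl, h1, h2⟩ := ih he
      exact ⟨f :: l₁, l₂, d, rfl, .cons f _ x z _ a c d hf hends h1 (by simp_all), h2⟩

/-- A ditrail can be cut right before any of its edges. -/
theorem exists_split_before (h : G.IsDitrail es x a y b) {e : E} (he : e ∈ es) :
    ∃ l₁ l₂ u d, es = l₁ ++ e :: l₂ ∧ (u, d) ∈ G.ends e ∧ G.IsDitrail l₁ x a u (-d) ∧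
      G.IsDitrail (e :: l₂) u d y b := by
  induction h with
  | nil _ _ hx => simp at he
  | cons f es x z y a c b hf hends htail hnew ih =>
    rcases List.mem_cons.1 he with rfl | he
    · have h := IsDitrail.cons e es x z y a c b hf hends htail hnew
      exact ⟨[], es, x, a, rfl, by simp [hends], .nil x a h.left_mem, h⟩
    · obtain ⟨l₁, l₂, u, d, rfl, h1, h2, h3⟩ := ih he
      exact ⟨f :: l₁, l₂, u, d, rfl, h1, .cons f _ x z _ a c _ hf hends h2 (by simp_all), h3⟩

theorem exists_last_edge (h : G.IsDitrail es x a y b) (hes : es ≠ []) :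
    ∃ e ∈ es, (y, b) ∈ G.ends e := by
  have h' := h.reverse
  cases hr : es.reverse with
  | nil => simp at hr; exact absurd hr hes
  | cons e l =>
    rw [hr] at h'
    refine ⟨e, List.mem_reverse.1 (by simp [hr]), ?_⟩
    cases h' with
    | cons _ _ _ z _ _ c _ he hends => simp [hends]

end IsDitrail

/-! ### Subgraphs -/

/-- The subgraph of `G` induced by the vertices in `X`. -/
def induce (G : BidirectedGraph V E) (X : Set V) : BidirectedGraph V E where
  vertexSet := G.vertexSet ∩ X
  edgeSet := {e ∈ G.edgeSet | ∀ p ∈ G.ends e, p.1 ∈ X}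
  ends := G.ends
  finite_vertexSet := G.finite_vertexSet.subset Set.inter_subset_left
  finite_edgeSet := G.finite_edgeSet.subset (Set.sep_subset _ _)
  ends_mem e he p hp := ⟨G.ends_mem e he.1 p hp, he.2 p hp⟩

theorem IsDitrail.of_induce {G : BidirectedGraph V E} {X : Set V} {es : List E} {x y : V}
    {a b : Sign} (h : (G.induce X).IsDitrail es x a y b) : G.IsDitrail es x a y b :=
  h.mono h.left_mem.1 fun e he => ⟨(h.edge_mem e he).1, rfl⟩

theorem IsDitrail.induce_mono {G : BidirectedGraph V E} {X Y : Set V} (hXY : X ⊆ Y)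
    {es : List E} {x y : V} {a b : Sign} (h : (G.induce X).IsDitrail es x a y b) :
    (G.induce Y).IsDitrail es x a y b :=
  h.mono ⟨h.left_mem.1, hXY h.left_mem.2⟩ fun e he =>
    ⟨⟨(h.edge_mem e he).1, fun p hp => hXY ((h.edge_mem e he).2 p hp)⟩, rfl⟩

/-- The subgraph obtained from `G` by deleting all edges with an end at `r` of sign `α`. -/
def deleteRootEdges (G : BidirectedGraph V E) (α : Sign) (r : V) : BidirectedGraph V E where
  vertexSet := G.vertexSet
  edgeSet := {e ∈ G.edgeSet | (r, α) ∉ G.ends e}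
  ends := G.ends
  finite_vertexSet := G.finite_vertexSet
  finite_edgeSet := G.finite_edgeSet.subset (Set.sep_subset _ _)
  ends_mem e he p hp := G.ends_mem e he.1 p hp

theorem isRootEdgeExtension_deleteRootEdges (G : BidirectedGraph V E) (α : Sign) (r : V) :
    IsRootEdgeExtension α r (G.deleteRootEdges α r) G where
  vertexSet_eq := rfl
  old_edge e he := ⟨he.1, rfl⟩
  new_edge e he := by
    have h : (r, α) ∈ G.ends e := by
      by_contra h
      exact he.2 ⟨he.1, h⟩
    obtain ⟨⟨v, b⟩, hv⟩ := Sym2.mem_iff_exists.1 h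
    exact ⟨v, G.ends_mem e he.1 (v, b) (by simp [hv]), b, hv⟩

/-- If the root `r` is sublinear, then adding edges with sign `α` at `r` creates no new
possibilities to reach `r` with sign `-α`. -/
theorem IsRootEdgeExtension.reach_subset {G K : BidirectedGraph V E} {α : Sign} {r : V}
    (hK : IsRootEdgeExtension α r G K) (hr : r ∉ G.reach r (-α) (-α)) (a : Sign) :
    K.reach r a (-α) ⊆ G.reach r a (-α) := by
  -- Tracking that only edges of the old ditrail are used keeps the edges distinct when one is
  -- prepended.
  suffices H : ∀ es x a y b, K.IsDitrail es x a y b → y = r → b = -α →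
      ∃ es', (∀ e ∈ es', e ∈ es) ∧ G.IsDitrail es' x a r (-α) by
    rintro x ⟨es, h⟩
    obtain ⟨es', -, h'⟩ := H _ _ _ _ _ h rfl rfl
    exact ⟨es', h'⟩
  intro es x a y b h
  induction h with
  | nil x a hx =>
    rintro rfl hb
    rw [neg_inj] at hb
    subst hb
    exact ⟨[], by simp, .nil _ _ (hK.vertexSet_eq ▸ hx)⟩
  | cons e es x z y a c b he hends htail hnew ih =>
    rintro rfl rfl
    obtain ⟨es', hsub, h'⟩ := ih rfl rfl
    by_cases heG : e ∈ G.edgeSet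
    · refine ⟨e :: es', ?_, .cons e es' x z y a c _ heG ?_ h' fun h => hnew (hsub e h)⟩
      · intro f hf
        rcases List.mem_cons.1 hf with rfl | hf
        · simp
        · simp [hsub f hf]
      · rw [← (hK.old_edge e heG).2, hends]
    -- A new edge has sign `α` at `r`. If it leaves `r`, the trivial ditrail replaces everything
    -- from there on; if it arrives at `r`, the tail would be a forbidden `(-α, -α)`-ditrail from
    -- `r` to `r`.
    · obtain ⟨v, hv, d, hd⟩ := hK.new_edge e ⟨he, heG⟩
      rw [hends] at hd
      rcases Sym2.eq_iff.1 hd with ⟨h1, -⟩ | ⟨-, h1⟩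
      · simp only [Prod.mk.injEq] at h1
        obtain ⟨rfl, rfl⟩ := h1
        exact ⟨[], by simp, .nil _ _ h'.right_mem⟩
      · simp only [Prod.mk.injEq] at h1
        obtain ⟨rfl, rfl⟩ := h1
        exact absurd ⟨es', h'⟩ hr

theorem IsRootEdgeExtension.subset_reach {G K : BidirectedGraph V E} {α : Sign} {r : V}
    (hK : IsRootEdgeExtension α r G K) (a b : Sign) : G.reach r a b ⊆ K.reach r a b := by
  rintro x ⟨es, h⟩
  exact ⟨es, h.mono (hK.vertexSet_eq ▸ h.left_mem) fun e he => hK.old_edge e (h.edge_mem e he)⟩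

/-! ### Contractions -/

open Classical in
/-- The map identifying all vertices of `H` with `s`. -/
noncomputable def collapse (H : BidirectedGraph V E) (s v : V) : V :=
  if v ∈ H.vertexSet then s else v

/-- `G` arises from `K` by contracting the subgraph `H` to the vertex `s`; the edges of `K` outside
`H` are renamed by `φ`, and their ends in `H` lie in `T`. -/
structure IsContraction (K G : BidirectedGraph V E) (s : V) (H : BidirectedGraph V E) (T : Set V)
    (φ : E → E) : Prop where
  root_mem : s ∈ G.vertexSet
  subset : T ⊆ H.vertexSet
  disjoint_vertexSet : Disjoint G.vertexSet H.vertexSet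
  vertexSet_eq : K.vertexSet = (G.vertexSet \ {s}) ∪ H.vertexSet
  right_edge : ∀ e ∈ H.edgeSet, e ∈ K.edgeSet ∧ K.ends e = H.ends e
  bijOn : Set.BijOn φ (K.edgeSet \ H.edgeSet) G.edgeSet
  ends_eq : ∀ e ∈ K.edgeSet \ H.edgeSet,
    G.ends (φ e) = (K.ends e).map fun p => (H.collapse s p.1, p.2)
  attach : ∀ e ∈ K.edgeSet \ H.edgeSet, ∀ p ∈ K.ends e, p.1 ∈ H.vertexSet → p.1 ∈ T

namespace IsContraction

variable {K G H : BidirectedGraph V E} {s : V} {T : Set V} {φ : E → E} {es : List E} {x y : V}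
  {a b c : Sign}

theorem collapse_eq_root (C : IsContraction K G s H T φ) {v : V} (hv : v ∈ K.vertexSet) :
    H.collapse s v = s ↔ v ∈ H.vertexSet := by
  unfold collapse
  split_ifs with h
  · simp [h]
  · simp only [h, iff_false]
    rintro rfl
    simp [C.vertexSet_eq, h] at hv

theorem ends_eq_mk (C : IsContraction K G s H T φ) {e : E} (he : e ∈ K.edgeSet)
    (heH : e ∉ H.edgeSet) {p q : V × Sign} (hends : K.ends e = s(p, q)) :
    G.ends (φ e) = s((H.collapse s p.1, p.2), (H.collapse s q.1, q.2)) := by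
  rw [C.ends_eq e ⟨he, heH⟩, hends, Sym2.map_mk]

theorem exists_ends (C : IsContraction K G s H T φ) {e : E} (he : e ∈ K.edgeSet)
    (heH : e ∉ H.edgeSet) (hends : G.ends (φ e) = s((x, a), (y, b))) :
    ∃ p q, K.ends e = s((p, a), (q, b)) ∧ H.collapse s p = x ∧ H.collapse s q = y := by
  obtain ⟨⟨p, a'⟩, ⟨q, b'⟩, hpq⟩ : ∃ p q, K.ends e = s(p, q) := by
    induction K.ends e with | _ p q => exact ⟨p, q, rfl⟩
  have h := C.ends_eq_mk he heH hpq
  rw [hends] at h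
  rcases Sym2.eq_iff.1 h with ⟨h1, h2⟩ | ⟨h1, h2⟩ <;> simp only [Prod.mk.injEq] at h1 h2 <;>
    obtain ⟨rfl, rfl⟩ := h1 <;> obtain ⟨rfl, rfl⟩ := h2
  · exact ⟨p, q, hpq, rfl, rfl⟩
  · exact ⟨q, p, by rw [hpq, Sym2.eq_swap], rfl, rfl⟩

theorem notMem_right_edge (C : IsContraction K G s H T φ) {e : E} {p : V × Sign}
    (hp : p ∈ K.ends e) (hpH : p.1 ∉ H.vertexSet) : e ∉ H.edgeSet := fun h =>
  hpH (H.ends_mem e h p ((C.right_edge e h).2 ▸ hp))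

theorem of_right (C : IsContraction K G s H T φ) (h : H.IsDitrail es x a y b) :
    K.IsDitrail es x a y b :=
  h.mono (by rw [C.vertexSet_eq]; exact Or.inr h.left_mem) fun e he =>
    C.right_edge e (h.edge_mem e he)

/-- A ditrail of `K` from outside `H` into `H` starts with a ditrail of the contraction. -/
theorem project (C : IsContraction K G s H T φ) (h : K.IsDitrail es x a y b)
    (hx : x ∉ H.vertexSet) (hy : y ∈ H.vertexSet) :
    ∃ es' t c rest, G.IsDitrail es' x a s c ∧ (∀ f ∈ es', ∃ e ∈ es, e ∉ H.edgeSet ∧ φ e = f) ∧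
      t ∈ T ∧ K.IsDitrail rest t (-c) y b ∧ rest.length < es.length := by
  induction h with
  | nil => exact absurd hy hx
  | cons e es x z y a c b he hends htail hnew ih =>
    have heH : e ∉ H.edgeSet := C.notMem_right_edge (p := (x, a)) (by simp [hends]) hx
    have hG := C.ends_eq_mk he heH hends
    simp only [collapse, hx, if_false] at hG
    have heG := C.bijOn.mapsTo ⟨he, heH⟩
    by_cases hz : z ∈ H.vertexSet
    · simp only [hz, if_true] at hG
      exact ⟨[φ e], z, c, es, .single heG hG, by simpa using Or.inl heH,
        C.attach e ⟨he, heH⟩ (z, c) (by simp [hends]) hz, htail, by simp⟩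
    · simp only [hz, if_false] at hG
      obtain ⟨es', t, d, rest, h1, h2, h3, h4, h5⟩ := ih hz hy
      refine ⟨φ e :: es', t, d, rest, .cons _ _ x z s a c d heG hG h1 ?_, ?_, h3, h4, ?_⟩
      -- `φ` is injective outside `H`, so a repetition after projection would be a repetition in
      -- `K`.
      · intro hmem
        obtain ⟨f, hf, hfH, hfe⟩ := h2 _ hmem
        rw [C.bijOn.injOn ⟨htail.edge_mem f hf, hfH⟩ ⟨he, heH⟩ hfe] at hf
        exact hnew hf
      · intro f hf
        rcases List.mem_cons.1 hf with rfl | hf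
        · exact ⟨e, by simp, heH, rfl⟩
        · obtain ⟨g, hg, hg'⟩ := h2 f hf
          exact ⟨g, by simp [hg], hg'⟩
      · simp only [List.length_cons]; omega

/-- A ditrail of `K` from `H` to `H` leaving `H` with its first edge starts with a closed
ditrail of the contraction. -/
theorem project_closed (C : IsContraction K G s H T φ) {e : E}
    (h : K.IsDitrail (e :: es) x a y b) (he' : e ∉ H.edgeSet) (hx : x ∈ H.vertexSet)
    (hy : y ∈ H.vertexSet) :
    ∃ es' t c rest, G.IsDitrail es' s a s c ∧ es' ≠ [] ∧
      t ∈ T ∧ K.IsDitrail rest t (-c) y b ∧ rest.length < es.length + 1 := by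
  cases h with
  | cons _ _ _ z _ _ c _ he hends htail hnew =>
    have hG := C.ends_eq_mk he he' hends
    simp only [collapse, hx, if_true] at hG
    have heG := C.bijOn.mapsTo ⟨he, he'⟩
    by_cases hz : z ∈ H.vertexSet
    · simp only [hz, if_true] at hG
      exact ⟨[φ e], z, c, es, .single heG hG, by simp,
        C.attach e ⟨he, he'⟩ (z, c) (by simp [hends]) hz, htail, by simp⟩
    · simp only [hz, if_false] at hG
      obtain ⟨es', t, d, rest, h1, h2, h3, h4, h5⟩ := C.project htail hz hy
      refine ⟨φ e :: es', t, d, rest, .cons _ _ s z s a c d heG hG h1 ?_, by simp, h3, h4, ?_⟩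
      · intro hmem
        obtain ⟨f, hf, hfH, hfe⟩ := h2 _ hmem
        rw [C.bijOn.injOn ⟨htail.edge_mem f hf, hfH⟩ ⟨he, he'⟩ hfe] at hf
        exact hnew hf
      · omega

/-- A ditrail of the contraction ending at the contracted vertex `s` lifts to a ditrail of `K`
up to its first visit of `s`. -/
theorem lift (C : IsContraction K G s H T φ) (h : G.IsDitrail es x a s b) (hx : x ≠ s) :
    ∃ es' t c, K.IsDitrail es' x a t c ∧ t ∈ T ∧ (∀ e ∈ es', e ∉ H.edgeSet ∧ φ e ∈ es) ∧
      ∃ es'', G.IsDitrail es'' s (-c) s b ∧ es''.length < es.length := by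
  generalize hs : s = s' at h
  induction h with
  | nil x a _ => exact absurd hs.symm hx
  | cons e es x z y a c b he hends htail hnew ih =>
    subst hs
    obtain ⟨e, ⟨heK, heH⟩, rfl⟩ := C.bijOn.surjOn he
    obtain ⟨p, q, hpq, hp, hq⟩ := C.exists_ends heK heH hends
    have hpx : p = x := by
      by_cases hpH : p ∈ H.vertexSet
      · simp only [collapse, hpH, if_true] at hp
        exact absurd hp.symm hx
      · simpa [collapse, hpH] using hp
    subst hpx
    have hqK : q ∈ K.vertexSet := K.ends_mem e heK (q, c) (by simp [hpq])
    by_cases hz : z = s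
    · subst hz
      refine ⟨[e], q, c, .single heK hpq, C.attach e ⟨heK, heH⟩ (q, c) (by simp [hpq])
        ((C.collapse_eq_root hqK).1 hq), by simp [heH], es, htail, by simp⟩
    · have hqH : q ∉ H.vertexSet := fun h => hz (hq ▸ (C.collapse_eq_root hqK).2 h)
      have hqz : q = z := by simpa [collapse, hqH] using hq
      subst hqz
      obtain ⟨es', t, d, h1, h2, h3, es'', h4, h5⟩ := ih hz rfl
      refine ⟨e :: es', t, d, .cons e es' p q t a c d heK hpq h1 fun h => hnew (h3 e h).2, h2, ?_,
        es'', h4, by simp only [List.length_cons]; omega⟩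
      intro f hf
      rcases List.mem_cons.1 hf with rfl | hf
      · exact ⟨heH, by simp⟩
      · exact ⟨(h3 f hf).1, by simp [(h3 f hf).2]⟩

end IsContraction

theorem collapse_of_notMem {H : BidirectedGraph V E} {s v : V} (hv : v ∉ H.vertexSet) :
    H.collapse s v = v := by simp [collapse, hv]

theorem collapse_of_mem {H : BidirectedGraph V E} {s v : V} (hv : v ∈ H.vertexSet) :
    H.collapse s v = s := by simp [collapse, hv]

theorem map_collapse_eq {H : BidirectedGraph V E} {s : V} {z : Sym2 (V × Sign)}
    (hz : ∀ p ∈ z, p.1 ∉ H.vertexSet) : z.map (fun p => (H.collapse s p.1, p.2)) = z :=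
  (Sym2.map_congr fun p hp => by rw [collapse_of_notMem (hz p hp)]; rfl).trans
    (congrFun Sym2.map_id z)

/-- The renaming undoes the gluing bijection on glued edges and fixes the other edges of `G`. An
edge that was a loop at `s` may have both ends in `H`, which is why only the edges of `H`, not all
edges between its vertices, are contracted. -/
theorem IsGluingSum.exists_isContraction {K G H : BidirectedGraph V E} {s : V} {T : Set V}
    (hK : IsGluingSum G s H T K) : ∃ φ, IsContraction K G s H T φ := by
  classical
  obtain ⟨f, hf, hf1, hf2⟩ := hK.glued_edge
  have hdisj : ∀ {v}, v ∈ G.vertexSet → v ∉ H.vertexSet := fun h =>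
    Set.disjoint_left.1 hK.disjoint_vertexSet h
  have hdisjE : ∀ {e}, e ∈ G.edgeSet → e ∉ H.edgeSet := fun h =>
    Set.disjoint_left.1 hK.disjoint_edgeSet h
  set g : E → E := fun e => if h : ∃ e₀ ∈ G.edgesAt s, f e₀ = e then h.choose else e with hg
  have hgf : ∀ e ∈ G.edgesAt s, g (f e) = e := by
    intro e he
    have h : ∃ e₀ ∈ G.edgesAt s, f e₀ = f e := ⟨e, he, rfl⟩
    simp only [hg, h, dif_pos]
    exact hf.injOn h.choose_spec.1 he h.choose_spec.2
  have hg' : ∀ e ∈ G.edgeSet \ G.edgesAt s, g e = e := by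
    intro e he
    have h : ¬ ∃ e₀ ∈ G.edgesAt s, f e₀ = e := by
      rintro ⟨e₀, h0, rfl⟩
      exact (hf.mapsTo h0).1.2 he
    simp only [hg, h, dif_neg, not_false_iff]
  have hcases : ∀ e ∈ K.edgeSet \ H.edgeSet,
      e ∈ G.edgeSet \ G.edgesAt s ∨ ∃ e₀ ∈ G.edgesAt s, f e₀ = e := by
    intro e he
    by_cases h : e ∈ G.edgeSet \ G.edgesAt s
    · exact Or.inl h
    · exact Or.inr (hf.surjOn ⟨⟨he.1, h⟩, he.2⟩)
  have hglue : ∀ e ∈ G.edgesAt s, ∃ p q, K.ends (f e) = s(p, q) ∧ p.1 ∈ T ∧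
      (q.1 ∈ H.vertexSet → q.1 ∈ T) ∧ G.ends e = s((s, p.2), (H.collapse s q.1, q.2)) := by
    intro e he
    obtain ⟨heG, v, a, b, hv⟩ := he
    have hvG : v ∈ G.vertexSet := G.ends_mem e heG (v, b) (by simp [hv])
    by_cases hvs : v = s
    · subst hvs
      obtain ⟨t, ht, t', ht', h⟩ := hf2 e ⟨heG, v, a, b, hv⟩ a b hv
      exact ⟨_, _, h, ht, fun _ => ht', by simp [hv, collapse_of_mem (hK.subset ht')]⟩
    · obtain ⟨t, ht, h⟩ := hf1 e ⟨heG, v, a, b, hv⟩ a v b hvs hv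
      exact ⟨_, _, h, ht, fun h => absurd h (hdisj hvG),
        by simp [hv, collapse_of_notMem (hdisj hvG)]⟩
  refine ⟨g, hK.root_mem, hK.subset, hK.disjoint_vertexSet, hK.vertexSet_eq, hK.right_edge,
    ⟨?_, ?_, ?_⟩, ?_, ?_⟩
  · intro e he
    rcases hcases e he with h | ⟨e₀, h, rfl⟩
    · rw [hg' e h]; exact h.1
    · rw [hgf e₀ h]; exact h.1
  · intro e he e' he' hee
    rcases hcases e he with h | ⟨e₀, h, rfl⟩ <;> rcases hcases e' he' with h' | ⟨e₀', h', rfl⟩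
    · rwa [hg' e h, hg' e' h'] at hee
    · rw [hg' e h, hgf e₀' h'] at hee
      exact absurd (hee ▸ h') h.2
    · rw [hg' e' h', hgf e₀ h] at hee
      exact absurd (hee ▸ h) h'.2
    · rw [hgf e₀ h, hgf e₀' h'] at hee
      rw [hee]
  · intro e he
    by_cases h : e ∈ G.edgesAt s
    · exact ⟨f e, ⟨(hf.mapsTo h).1.1, (hf.mapsTo h).2⟩, hgf e h⟩
    · exact ⟨e, ⟨(hK.left_edge e ⟨he, h⟩).1, hdisjE he⟩, hg' e ⟨he, h⟩⟩
  · intro e he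
    rcases hcases e he with h | ⟨e₀, h, rfl⟩
    · rw [hg' e h, (hK.left_edge e h).2]
      exact (map_collapse_eq fun p hp => hdisj (G.ends_mem e h.1 p hp)).symm
    · obtain ⟨p, q, h1, h2, h3, h4⟩ := hglue e₀ h
      rw [hgf e₀ h, h1, h4, Sym2.map_mk, collapse_of_mem (hK.subset h2)]
  · intro e he p hp hpH
    rcases hcases e he with h | ⟨e₀, h, rfl⟩
    · rw [(hK.left_edge e h).2] at hp
      exact absurd hpH (hdisj (G.ends_mem e h.1 p hp))
    · obtain ⟨p', q, h1, h2, h3, h4⟩ := hglue e₀ h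
      rw [h1, Sym2.mem_iff] at hp
      rcases hp with rfl | rfl
      · exact h2
      · exact h3 hpH

/-- The graph obtained from `K` by contracting `X` to the vertex `s`. -/
noncomputable def contract (K : BidirectedGraph V E) (X : Set V) (s : V) :
    BidirectedGraph V E where
  vertexSet := (K.vertexSet \ X) ∪ {s}
  edgeSet := K.edgeSet \ (K.induce X).edgeSet
  ends e := (K.ends e).map fun p => ((K.induce X).collapse s p.1, p.2)
  finite_vertexSet := (K.finite_vertexSet.subset Set.sdiff_subset).union (Set.finite_singleton s)
  finite_edgeSet := K.finite_edgeSet.subset Set.sdiff_subset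
  ends_mem e he p hp := by
    obtain ⟨q, hq, rfl⟩ := Sym2.mem_map.1 hp
    by_cases h : q.1 ∈ (K.induce X).vertexSet
    · simp [collapse_of_mem h]
    · have := K.ends_mem e he.1 q hq
      simp only [collapse_of_notMem h]
      exact Or.inl ⟨this, fun h' => h ⟨this, h'⟩⟩

/-- If all neighbors of `r` lie in `X`, no edge at `r` survives the contraction, so the surviving
edges attach to `X` away from `r`, as the gluing rules demand. -/
theorem isContraction_contract {K : BidirectedGraph V E} {X : Set V} {r s : V}
    (hs : s ∉ K.vertexSet)
    (hr : ∀ e ∈ K.edgeSet, ∀ a v b, K.ends e = s((r, a), (v, b)) → v ∈ X) (hrX : r ∈ X) :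
    IsContraction K (K.contract X s) s (K.induce X) ((K.induce X).vertexSet \ {r}) id where
  root_mem := Or.inr rfl
  subset := Set.sdiff_subset
  disjoint_vertexSet := by
    rw [Set.disjoint_left]
    rintro v (hv | rfl) hv'
    · exact hv.2 hv'.2
    · exact hs hv'.1
  vertexSet_eq := by
    ext v
    have hvs : v ∈ K.vertexSet → v ≠ s := by rintro h rfl; exact hs h
    simp only [contract, induce, Set.mem_union, Set.mem_sdiff, Set.mem_singleton_iff,
      Set.mem_inter_iff]
    tauto
  right_edge e he := ⟨he.1, rfl⟩
  bijOn := Set.bijOn_id _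
  ends_eq e he := rfl
  attach := by
    rintro e he ⟨p, a⟩ hp hpH
    refine ⟨hpH, ?_⟩
    rintro rfl
    obtain ⟨⟨q, b⟩, hq⟩ := Sym2.mem_iff_exists.1 hp
    refine he.2 ⟨he.1, fun u hu => ?_⟩
    rw [hq, Sym2.mem_iff] at hu
    rcases hu with rfl | rfl
    · exact hrX
    · exact hr e he.1 a q b hq

theorem IsContraction.exists_ends_of_ne_root {K G H : BidirectedGraph V E} {s : V} {T : Set V}
    (C : IsContraction K G s H T id) {e : E} {v : V} {a b : Sign} (he : e ∈ K.edgeSet \ H.edgeSet)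
    (hv : v ≠ s) (hends : G.ends e = s((s, a), (v, b))) :
    ∃ p, K.ends e = s((p, a), (v, b)) ∧ p ∈ T := by
  obtain ⟨p, q, hpq, hp, hq⟩ := C.exists_ends he.1 he.2 hends
  have hqH : q ∉ H.vertexSet := fun h => hv (by rw [← hq, collapse_of_mem h])
  rw [collapse_of_notMem hqH] at hq
  subst hq
  have hpK : p ∈ K.vertexSet := K.ends_mem e he.1 (p, a) (by simp [hpq])
  exact ⟨p, hpq, C.attach e he (p, a) (by simp [hpq]) ((C.collapse_eq_root hpK).1 hp)⟩

/-- As edges keep their names, the identity serves as the gluing bijection. -/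
theorem IsContraction.isGluingSum {K G H : BidirectedGraph V E} {s : V} {T : Set V}
    (C : IsContraction K G s H T id) : IsGluingSum G s H T K := by
  have hGE : G.edgeSet = K.edgeSet \ H.edgeSet := by
    have := C.bijOn.image_eq
    simpa using this.symm
  refine ⟨C.root_mem, C.subset, C.disjoint_vertexSet, ?_, C.vertexSet_eq, ?_, C.right_edge, id,
    ?_, ?_, ?_⟩
  · rw [hGE]; exact Set.disjoint_sdiff_left
  · rintro e ⟨heG, hes⟩
    have he := hGE ▸ heG
    refine ⟨he.1, ?_⟩
    have h := C.ends_eq e he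
    rw [id] at h
    rw [h]
    refine (map_collapse_eq fun p hp hpH => ?_).symm
    obtain ⟨q, hq⟩ := Sym2.mem_iff_exists.1 hp
    rw [hq, Sym2.map_mk, collapse_of_mem hpH] at h
    exact hes ⟨heG, _, _, _, h⟩
  · have : G.edgesAt s = (K.edgeSet \ (G.edgeSet \ G.edgesAt s)) \ H.edgeSet := by
      have hsub : G.edgesAt s ⊆ G.edgeSet := fun e he => he.1
      ext e
      have := @hsub e
      rw [hGE] at this ⊢
      simp only [Set.mem_sdiff] at this ⊢
      tauto
    rw [← this]
    exact Set.bijOn_id _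
  · intro e he a v b hv hends
    obtain ⟨p, hpq, hp⟩ := C.exists_ends_of_ne_root (hGE ▸ he.1) hv hends
    exact ⟨p, hp, hpq⟩
  · intro e he a b hends
    have heK := hGE ▸ he.1
    obtain ⟨p, q, hpq, hp, hq⟩ := C.exists_ends heK.1 heK.2 hends
    have hpK : p ∈ K.vertexSet := K.ends_mem e heK.1 (p, a) (by simp [hpq])
    have hqK : q ∈ K.vertexSet := K.ends_mem e heK.1 (q, b) (by simp [hpq])
    exact ⟨p, C.attach e heK (p, a) (by simp [hpq]) ((C.collapse_eq_root hpK).1 hp),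
      q, C.attach e heK (q, b) (by simp [hpq]) ((C.collapse_eq_root hqK).1 hq), hpq⟩

theorem ncard_contract_lt {K : BidirectedGraph V E} {X : Set V} {s x y : V}
    (hX : X ⊆ K.vertexSet) (hx : x ∈ X) (hy : y ∈ X) (hxy : x ≠ y) :
    (K.contract X s).vertexSet.ncard < K.vertexSet.ncard := by
  have hfin := K.finite_vertexSet.subset hX
  have h1 : 1 < X.ncard := (Set.one_lt_ncard hfin).2 ⟨x, hx, y, hy, hxy⟩
  have h2 := Set.ncard_sdiff_add_ncard_of_subset hX K.finite_vertexSet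
  have h3 := Set.ncard_union_le (K.vertexSet \ X) {s}
  rw [Set.ncard_singleton] at h3
  change ((K.vertexSet \ X) ∪ {s}).ncard < _
  omega

/-! ### The families consist of round radials and sharp semiradials -/

theorem isSublinearVertex_root_iff {G : BidirectedGraph V E} {α : Sign} {r : V}
    (hr : r ∈ G.vertexSet) :
    G.IsSublinearVertex α r r ↔ r ∉ G.reach r (-α) (-α) :=
  ⟨fun h => h.2, fun h => ⟨⟨[], .nil r α hr⟩, h⟩⟩

theorem IsAlmostStrongRadial.isRoundRadial {G : BidirectedGraph V E} {α : Sign} {r : V}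
    (hG : G.IsAlmostStrongRadial α r) : G.IsRoundRadial α r := by
  refine ⟨hG.1, (isSublinearVertex_root_iff hG.1.1).2 hG.2.2, ?_⟩
  rintro v ⟨hv, e, he, u, -, b, h⟩
  have hvG : v ∈ G.vertexSet := G.ends_mem e he (v, b) (by simp [h])
  exact ⟨hG.1.2 v hvG, hG.2.1 v hvG hv⟩

theorem IsLinearSemiradial.isSharpSemiradial {G : BidirectedGraph V E} {α : Sign} {r : V}
    (hG : G.IsLinearSemiradial α r) : G.IsSharpSemiradial α r := by
  refine ⟨hG.1, hG.2.1, ?_⟩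
  rintro v ⟨a, hv, e, he, u, -, b, h⟩
  have hvG : v ∈ G.vertexSet := G.ends_mem e he (v, b) (by simp [h])
  refine ⟨hG.1.2 v hvG, ?_⟩
  rintro ⟨c, es, hes⟩
  exact hes.ne_nil hv (hG.2.2 _ _ _ hes)

theorem IsRoundRadial.of_isRootEdgeExtension {G K : BidirectedGraph V E} {α : Sign} {r : V}
    (hG : G.IsRoundRadial α r) (hK : IsRootEdgeExtension α r G K) : K.IsRoundRadial α r := by
  obtain ⟨hrad, hsub, hnb⟩ := hG
  refine ⟨⟨hK.vertexSet_eq ▸ hrad.1, ?_⟩, ?_, ?_⟩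
  · intro v hv
    exact hK.subset_reach _ _ (hrad.2 v (hK.vertexSet_eq ▸ hv))
  · rw [isSublinearVertex_root_iff (hK.vertexSet_eq ▸ hrad.1)]
    exact fun h => hsub.2 (hK.reach_subset hsub.2 _ h)
  · rintro v ⟨hv, e, he, u, hu, b, h⟩
    rw [Set.mem_singleton_iff] at hu
    subst hu
    have heG : e ∈ G.edgeSet := by
      by_contra heG
      obtain ⟨w, -, d, hd⟩ := hK.new_edge e ⟨he, heG⟩
      rw [h] at hd
      rcases Sym2.eq_iff.1 hd with ⟨h1, -⟩ | ⟨-, h1⟩ <;> simp only [Prod.mk.injEq] at h1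
      · exact sign_ne_neg α h1.2.symm
      · exact hv h1.1
    have hs := hnb v ⟨hv, e, heG, u, rfl, b, by rw [← (hK.old_edge e heG).2, h]⟩
    exact ⟨hK.subset_reach _ _ hs.1, hK.subset_reach _ _ hs.2⟩

/-- The first edge leads to a neighbor `z`. If its sign at `z` is `α`, the rest of the ditrail
leaves `z` with `-α`; otherwise the edge itself, reversed, does. Both contradict the linearity of
`z`. -/
theorem IsSharpSemiradial.eq_nil {G : BidirectedGraph V E} {α : Sign} {s : V}
    (hG : G.IsSharpSemiradial α s) {es : List E} {a b : Sign} (h : G.IsDitrail es s a s b) :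
    es = [] := by
  obtain ⟨-, hloop, hnb⟩ := hG
  cases h with
  | nil => rfl
  | cons e es _ z _ _ c _ he hends htail hnew =>
    have hz : z ≠ s := by
      rintro rfl
      have : e ∈ G.loopsAt z := ⟨he, a, c, hends⟩
      simp [hloop] at this
    have hlin := hnb z ⟨a, hz, e, he, s, rfl, c, hends⟩
    refine absurd ?_ hlin.2
    rcases sign_eq_or_eq_neg c α with rfl | rfl
    · exact ⟨b, es, htail⟩
    · exact ⟨a, [e], .single he (by rw [hends, Sym2.eq_swap])⟩

variable {K G H : BidirectedGraph V E} {α : Sign} {r s : V} {φ : E → E}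

/-- An excursion out of `H` would project to a nontrivial closed ditrail at the root of a sharp
semiradial. -/
theorem IsContraction.ditrail_of_sharp {T : Set V} (C : IsContraction K G s H T φ)
    (hG : G.IsSharpSemiradial α s) {es : List E} {x y : V} {a b : Sign}
    (h : K.IsDitrail es x a y b) (hx : x ∈ H.vertexSet) (hy : y ∈ H.vertexSet) :
    H.IsDitrail es x a y b := by
  induction h with
  | nil => exact .nil _ _ hx
  | cons e es x z y a c b he hends htail hnew ih =>
    by_cases heH : e ∈ H.edgeSet
    · have hends' := (C.right_edge e heH).2 ▸ hends
      exact .cons e es x z y a c b heH hends'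
        (ih (H.ends_mem e heH (z, c) (by simp [hends'])) hy) hnew
    · obtain ⟨es', t, d, rest, h1, h2, -⟩ :=
        C.project_closed (.cons e es x z y a c b he hends htail hnew) heH hx hy
      exact absurd (hG.eq_nil h1) h2

theorem IsContraction.right_edge_of_root
    (C : IsContraction K G s H (H.vertexSet \ {r}) φ) (hr : r ∈ H.vertexSet) {e : E}
    (he : e ∈ K.edgeSet) {a : Sign} (hends : (r, a) ∈ K.ends e) : e ∈ H.edgeSet := by
  by_contra h
  exact (C.attach e ⟨he, h⟩ _ hends hr).2 rfl

/-- A lifted ditrail enters `H` at a vertex other than `r`, from which the almost strong `H` allows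
it to continue with either sign. Sublinearity of `r` is inherited from `H`, since ditrails between
vertices of `H` stay inside `H`. -/
theorem IsContraction.isRoundRadial (C : IsContraction K G s H (H.vertexSet \ {r}) φ)
    (hG : G.IsSharpSemiradial α s) (hH : H.IsAlmostStrongRadial α r) :
    K.IsRoundRadial α r := by
  have hHreach : ∀ v ∈ H.vertexSet, ∀ a, v ≠ r → ∃ es, H.IsDitrail es v a r (-α) := by
    intro v hv a hvr
    rcases sign_eq_or_eq_neg a α with rfl | rfl
    · exact hH.1.2 v hv
    · exact hH.2.1 v hv hvr
  have hrK : r ∈ K.vertexSet := by rw [C.vertexSet_eq]; exact Or.inr hH.1.1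
  refine ⟨⟨hrK, ?_⟩, (isSublinearVertex_root_iff hrK).2 ?_, ?_⟩
  · intro v hv
    rw [C.vertexSet_eq] at hv
    rcases hv with ⟨hvG, hvs⟩ | hv
    · obtain ⟨b, es, hes⟩ := hG.1.2 v hvG
      obtain ⟨es', t, c, h1, h2, h3, -⟩ := C.lift hes hvs
      obtain ⟨l, hl⟩ := hHreach t h2.1 (-c) h2.2
      exact ⟨es' ++ l, h1.append (C.of_right hl) fun e he hel => (h3 e he).1 (hl.edge_mem e hel)⟩
    · obtain ⟨es, hes⟩ := hH.1.2 v hv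
      exact ⟨es, C.of_right hes⟩
  · rintro ⟨es, hes⟩
    exact hH.2.2 ⟨es, C.ditrail_of_sharp hG hes hH.1.1 hH.1.1⟩
  · rintro v ⟨hv, e, he, u, hu, b, h⟩
    rw [Set.mem_singleton_iff] at hu
    subst hu
    have heH : e ∈ H.edgeSet := C.right_edge_of_root hH.1.1 he (a := -α) (by simp [h])
    have hvH : v ∈ H.vertexSet :=
      H.ends_mem e heH (v, b) (by rw [← (C.right_edge e heH).2, h]; simp)
    obtain ⟨l, hl⟩ := hHreach v hvH α hv
    obtain ⟨l', hl'⟩ := hHreach v hvH (-α) hv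
    exact ⟨⟨l, C.of_right hl⟩, l', C.of_right hl'⟩

/-- Take an `α`-ditrail from `v` to the root. If it avoids `e`, prepending `e` gives a nontrivial
`-α`-ditrail; if it uses `e`, its part starting with `e` is one. -/
theorem IsLinearSemiradial.ends_ne (hH : H.IsLinearSemiradial α r) {e : E} (he : e ∈ H.edgeSet)
    (u v : V) : H.ends e ≠ s((u, -α), (v, -α)) := by
  intro h
  obtain ⟨b, es, hes⟩ := hH.1.2 v (H.ends_mem e he (v, -α) (by simp [h]))
  by_cases hmem : e ∈ es
  · obtain ⟨-, l, w, d, -, hd, -, hl⟩ := hes.exists_split_before hmem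
    have : d = -α := by
      rw [h, Sym2.mem_iff] at hd
      rcases hd with hd | hd <;> exact congrArg Prod.snd hd
    subst this
    exact absurd (hH.2.2 _ _ _ hl) (by simp)
  · have := IsDitrail.cons e es u v r (-α) (-α) b he h (by rwa [neg_neg]) hmem
    exact absurd (hH.2.2 _ _ _ this) (by simp)

/-- Whenever the ditrail leaves a vertex of `H` with `-α`, its next visit to `H` arrives with `α`:
inside `H` by `IsLinearSemiradial.ends_ne`, outside because the root of `G` is not reached from
itself by a `(-α, -α)`-ditrail. So it keeps leaving with `-α`, and could reach `r` only by an edge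
of `H`, which linearity forbids. -/
theorem IsContraction.eq_nil_of_linear (C : IsContraction K G s H (H.vertexSet \ {r}) φ)
    (hG : s ∉ G.reach s (-α) (-α)) (hH : H.IsLinearSemiradial α r) {es : List E} {x : V}
    {b : Sign} (h : K.IsDitrail es x (-α) r b) (hx : x ∈ H.vertexSet) : es = [] := by
  induction hn : es.length using Nat.strong_induction_on generalizing es x with
  | _ n ih =>
    subst hn
    match es, h with
    | [], _ => rfl
    | e :: es, h =>
      exfalso
      by_cases heH : e ∈ H.edgeSet
      · cases h with
        | cons _ _ _ z _ _ c _ he hends htail hnew =>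
          have hends' := (C.right_edge e heH).2 ▸ hends
          rcases sign_eq_or_eq_neg c α with rfl | rfl
          · have hz : z ∈ H.vertexSet := H.ends_mem e heH (z, c) (by simp [hends'])
            have := ih es.length (by simp) htail hz rfl
            subst this
            obtain ⟨rfl, -⟩ := htail.eq_of_nil
            exact absurd (hH.2.2 _ _ _ (.single heH hends')) (by simp)
          · exact hH.ends_ne heH _ _ hends'
      · obtain ⟨es', t, c, rest, h1, -, h3, h4, h5⟩ := C.project_closed h heH hx hH.1.1
        rcases sign_eq_or_eq_neg c α with rfl | rfl
        · have := ih rest.length (by simpa using h5) h4 h3.1 rfl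
          subst this
          exact h3.2 h4.eq_of_nil.1
        · exact hG ⟨es', h1⟩

theorem IsContraction.isSharpSemiradial (C : IsContraction K G s H (H.vertexSet \ {r}) φ)
    (hG : G.IsRoundRadial α s) (hH : H.IsLinearSemiradial α r) :
    K.IsSharpSemiradial α r := by
  have hsemi : K.IsSemiradial α r := by
    refine ⟨by rw [C.vertexSet_eq]; exact Or.inr hH.1.1, fun v hv => ?_⟩
    rw [C.vertexSet_eq] at hv
    rcases hv with ⟨hvG, hvs⟩ | hv
    · obtain ⟨es, hes⟩ := hG.1.2 v hvG
      obtain ⟨es', t, c, h1, h2, h3, es'', h4, -⟩ := C.lift hes hvs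
      -- Arriving at `s` first with `α` would leave a remainder `es''` that is a `(-α, -α)`-ditrail
      -- from `s` to `s`. Hence the arrival sign is `-α`, and `H` only has to supply an `α`-ditrail.
      rcases sign_eq_or_eq_neg c α with rfl | rfl
      · exact absurd ⟨es'', h4⟩ hG.2.1.2
      · obtain ⟨b, l, hl⟩ := hH.1.2 t h2.1
        refine ⟨b, es' ++ l, h1.append (C.of_right ?_) fun e he hel =>
          (h3 e he).1 (hl.edge_mem e hel)⟩
        rwa [neg_neg]
    · obtain ⟨b, es, hes⟩ := hH.1.2 v hv
      exact ⟨b, es, C.of_right hes⟩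
  refine ⟨hsemi, ?_, ?_⟩
  · rw [Set.eq_empty_iff_forall_notMem]
    rintro e ⟨he, a, b, h⟩
    have heH : e ∈ H.edgeSet := C.right_edge_of_root hH.1.1 he (a := a) (by simp [h])
    have : e ∈ H.loopsAt r := ⟨heH, a, b, by rw [← (C.right_edge e heH).2, h]⟩
    simp [hH.2.1] at this
  · rintro v ⟨a, hv, e, he, u, hu, b, h⟩
    rw [Set.mem_singleton_iff] at hu
    subst hu
    have heH : e ∈ H.edgeSet := C.right_edge_of_root hH.1.1 he (a := a) (by simp [h])
    have hvH : v ∈ H.vertexSet :=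
      H.ends_mem e heH (v, b) (by rw [← (C.right_edge e heH).2, h]; simp)
    refine ⟨hsemi.2 v (K.ends_mem e he (v, b) (by simp [h])), ?_⟩
    rintro ⟨c, es, hes⟩
    exact hes.ne_nil hv (C.eq_nil_of_linear hG.2.1.2 hH hes hvH)

mutual

theorem RoundFamily.isRoundRadial {α : Sign} {r : V} {G : BidirectedGraph V E}
    (h : RoundFamily α r G) : G.IsRoundRadial α r :=
  match h with
  | .base _ _ hG => hG.isRoundRadial
  | .addEdges _ _ _ hG hK => (RoundFamily.isRoundRadial hG).of_isRootEdgeExtension hK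
  | .glue _ _ _ _ _ hG hH hK =>
    let ⟨_, C⟩ := hK.exists_isContraction
    C.isRoundRadial (SharpFamily.isSharpSemiradial hG) hH

theorem SharpFamily.isSharpSemiradial {α : Sign} {r : V} {G : BidirectedGraph V E}
    (h : SharpFamily α r G) : G.IsSharpSemiradial α r :=
  match h with
  | .base _ _ hG => hG.isSharpSemiradial
  | .glue _ _ _ _ _ hG hH hK =>
    let ⟨_, C⟩ := hK.exists_isContraction
    C.isSharpSemiradial (RoundFamily.isRoundRadial hG) hH

end


theorem IsDitrail.to_induce {X : Set V} {es : List E} {x y : V} {a b : Sign}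
    (h : K.IsDitrail es x a y b) (hx : x ∈ X) (hX : ∀ e ∈ es, ∀ p ∈ K.ends e, p.1 ∈ X) :
    (K.induce X).IsDitrail es x a y b :=
  h.mono ⟨h.left_mem, hx⟩ fun e he => ⟨⟨h.edge_mem e he, hX e he⟩, rfl⟩

theorem loopsAt_contract {X T : Set V}
    (C : IsContraction K (K.contract X s) s (K.induce X) T id) :
    (K.contract X s).loopsAt s = ∅ := by
  rw [Set.eq_empty_iff_forall_notMem]
  rintro e ⟨he, a, b, h⟩
  obtain ⟨p, q, hpq, hp, hq⟩ := C.exists_ends he.1 he.2 h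
  refine he.2 ⟨he.1, fun u hu => ?_⟩
  have huK := K.ends_mem e he.1 u hu
  rw [hpq, Sym2.mem_iff] at hu
  rcases hu with rfl | rfl
  · exact ((C.collapse_eq_root huK).1 hp).2
  · exact ((C.collapse_eq_root huK).1 hq).2

/-! ### Decomposition of sharp semiradials -/

/-- The set `Y` induces a linear semiradial of vertices which are linear in `K`. -/
def IsLinearSet (K : BidirectedGraph V E) (α : Sign) (r : V) (Y : Set V) : Prop :=
  r ∈ Y ∧ Y ⊆ K.vertexSet ∧
    ∀ x ∈ Y, x ∈ (K.induce Y).reachAny r α ∧ (x ≠ r → x ∉ K.reachAny r (-α))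

/-- The largest linear set. -/
def linearPart (K : BidirectedGraph V E) (α : Sign) (r : V) : Set V :=
  ⋃₀ {Y | K.IsLinearSet α r Y}

theorem isLinearSet_linearPart (hr : r ∈ K.vertexSet) :
    K.IsLinearSet α r (K.linearPart α r) := by
  refine ⟨⟨{r}, ⟨rfl, by simpa using hr, ?_⟩, rfl⟩, Set.sUnion_subset fun Y hY => hY.2.1, ?_⟩
  · rintro x rfl
    exact ⟨⟨_, [], .nil x α ⟨hr, rfl⟩⟩, fun h => absurd rfl h⟩
  · rintro x ⟨Y, hY, hx⟩
    obtain ⟨⟨b, es, h⟩, h'⟩ := hY.2.2 x hx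
    exact ⟨⟨b, es, h.induce_mono (Set.subset_sUnion_of_mem hY)⟩, h'⟩

/-- From `v`, cross `e` to `t` and continue with `α` inside `X`; the continuation avoids `e` because
`v` is outside `X`. For `t = r` the edge alone suffices, whatever its sign there. -/
theorem IsLinearSet.insert {X : Set V} (hX : K.IsLinearSet α r X) {v t : V} {a : Sign} {e : E}
    (he : e ∈ K.edgeSet) (hends : K.ends e = s((t, a), (v, α))) (ht : t ∈ X)
    (hat : t ≠ r → a = -α) (hv : v ∉ K.reachAny r (-α)) (hvX : v ∉ X) :
    K.IsLinearSet α r (insert v X) := by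
  have hvK : v ∈ K.vertexSet := K.ends_mem e he (v, α) (by simp [hends])
  have heX : e ∈ (K.induce (Insert.insert v X)).edgeSet := by
    refine ⟨he, fun p hp => ?_⟩
    rw [hends, Sym2.mem_iff] at hp
    rcases hp with rfl | rfl
    · exact Or.inr ht
    · exact Or.inl rfl
  refine ⟨Or.inr hX.1, Set.insert_subset hvK hX.2.1, ?_⟩
  rintro x (rfl | hx)
  · refine ⟨?_, fun _ => hv⟩
    by_cases htr : t = r
    · subst htr
      exact ⟨a, [e], .single heX (by rw [Sym2.eq_swap]; exact hends)⟩
    · obtain rfl := hat htr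
      obtain ⟨⟨b, es, h⟩, -⟩ := hX.2.2 t ht
      refine ⟨b, e :: es, .cons e es x t r α (-α) b heX (by rw [Sym2.eq_swap]; exact hends)
        ?_ fun hmem => ?_⟩
      · rw [neg_neg]
        exact h.induce_mono (Set.subset_insert _ _)
      · exact hvX ((h.edge_mem e hmem).2 (x, α) (by simp [hends]))
  · obtain ⟨⟨b, es, h⟩, h'⟩ := hX.2.2 x hx
    exact ⟨⟨b, es, h.induce_mono (Set.subset_insert _ _)⟩, h'⟩

theorem mem_linearPart_of_edge (hr : r ∈ K.vertexSet) {v t : V} {a : Sign} {e : E}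
    (he : e ∈ K.edgeSet) (hends : K.ends e = s((t, a), (v, α))) (ht : t ∈ K.linearPart α r)
    (hat : t ≠ r → a = -α) (hv : v ∉ K.reachAny r (-α)) : v ∈ K.linearPart α r := by
  by_contra hvX
  exact hvX (Set.mem_sUnion.2 ⟨_, (isLinearSet_linearPart hr).insert he hends ht hat hv hvX,
    Set.mem_insert _ _⟩)

theorem IsLinearSet.isLinearSemiradial {X : Set V} (hX : K.IsLinearSet α r X)
    (hloop : K.loopsAt r = ∅) : (K.induce X).IsLinearSemiradial α r := by
  refine ⟨⟨⟨hX.2.1 hX.1, hX.1⟩, fun v hv => (hX.2.2 v hv.2).1⟩, ?_, ?_⟩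
  · rw [Set.eq_empty_iff_forall_notMem] at hloop ⊢
    rintro e ⟨he, h⟩
    exact hloop e ⟨he.1, h⟩
  · intro es x b h
    by_cases hx : x = r
    · subst hx
      cases h with
      | nil => rfl
      | cons e es _ z _ _ c _ he hends htail hnew =>
        have hz : z ≠ x := by
          rintro rfl
          have : e ∈ K.loopsAt z := ⟨he.1, _, _, hends⟩
          simp [hloop] at this
        refine absurd ?_ ((hX.2.2 z htail.left_mem.2).2 hz)
        rcases sign_eq_or_eq_neg c α with rfl | rfl
        · exact ⟨b, es, htail.of_induce⟩
        · exact ⟨-α, [e], .single he.1 (by rw [Sym2.eq_swap]; exact hends)⟩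
    · exact absurd ⟨b, es, h.of_induce⟩ ((hX.2.2 x h.left_mem.2).2 hx)

/-- An edge from `r` with sign `-α` at the neighbor would itself violate linearity, so the sign is
`α` and maximality applies. -/
theorem IsSharpSemiradial.mem_linearPart (hK : K.IsSharpSemiradial α r) {e : E}
    (he : e ∈ K.edgeSet) (a : Sign) (v : V) (b : Sign) (h : K.ends e = s((r, a), (v, b))) :
    v ∈ K.linearPart α r := by
  have hrX := (isLinearSet_linearPart (α := α) hK.1.1).1
  by_cases hv : v = r
  · exact hv ▸ hrX
  · have hlin := hK.2.2 v ⟨a, hv, e, he, r, rfl, b, h⟩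
    rcases sign_eq_or_eq_neg b α with rfl | rfl
    · exact mem_linearPart_of_edge hK.1.1 he h hrX (fun h => absurd rfl h) hlin.2
    · exact absurd ⟨a, [e], .single he (by rw [h, Sym2.eq_swap])⟩ hlin.2

theorem IsSharpSemiradial.isContraction (hK : K.IsSharpSemiradial α r) (hs : s ∉ K.vertexSet) :
    IsContraction K (K.contract (K.linearPart α r) s) s (K.induce (K.linearPart α r))
      ((K.induce (K.linearPart α r)).vertexSet \ {r}) id :=
  isContraction_contract hs (fun _ he => hK.mem_linearPart he)
    (isLinearSet_linearPart hK.1.1).1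

theorem IsSharpSemiradial.isRoundRadial_contract (hK : K.IsSharpSemiradial α r)
    (hs : s ∉ K.vertexSet) : (K.contract (K.linearPart α r) s).IsRoundRadial α s := by
  have hX := isLinearSet_linearPart (α := α) hK.1.1
  have C := hK.isContraction hs
  set X := K.linearPart α r with hXdef
  have hsG := C.root_mem
  -- The first entry into `X` is at some `t ≠ r` and must have sign `-α`, since otherwise the
  -- remainder would be a `-α`-ditrail from the linear vertex `t`.
  have hproj : ∀ v ∉ X, ∀ a, v ∈ K.reachAny r a → v ∈ (K.contract X s).reach s a (-α) := by
    rintro v hv a ⟨b, es, h⟩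
    obtain ⟨es', t, c, rest, h1, -, h3, h4, -⟩ :=
      C.project h (fun h => hv h.2) ⟨hK.1.1, hX.1⟩
    rcases sign_eq_or_eq_neg c α with rfl | rfl
    · exact absurd ⟨b, rest, h4⟩ ((hX.2.2 t h3.1.2).2 h3.2)
    · exact ⟨es', h1⟩
  have hrad : (K.contract X s).IsRadial α s := by
    refine ⟨hsG, ?_⟩
    rintro v (hv | rfl)
    · exact hproj v hv.2 α (hK.1.2 v hv.1)
    · exact ⟨[], .nil v α hsG⟩
  refine ⟨hrad, (isSublinearVertex_root_iff hsG).2 ?_, ?_⟩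
  -- A closed ditrail at `s` leaving with `-α` is cut at its first return. A return with `α` leaves
  -- a shorter ditrail of the same kind; a return with `-α` continues inside `X` to `r`, giving a
  -- `-α`-ditrail from a linear vertex.
  · suffices H : ∀ n, ∀ es : List E, es.length = n → ∀ b,
        (K.contract X s).IsDitrail es s (-α) s b → b = α by
      rintro ⟨es, h⟩
      exact sign_ne_neg α (H _ es rfl _ h).symm
    intro n
    induction n using Nat.strong_induction_on with
    | _ n ih =>
      rintro es rfl b h
      cases h with
      | nil => simp
      | cons e es _ z _ _ c _ he hends htail hnew =>
        have hz : z ≠ s := by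
          rintro rfl
          have : e ∈ (K.contract X z).loopsAt z := ⟨he, _, _, hends⟩
          simp [loopsAt_contract C] at this
        obtain ⟨es', t, d, h1, h2, h3, es'', h4, h5⟩ := C.lift htail hz
        rcases sign_eq_or_eq_neg d α with rfl | rfl
        · exact ih _ (by simp only [List.length_cons]; omega) es'' rfl b h4
        · exfalso
          obtain ⟨p, hpq, hpX⟩ := C.exists_ends_of_ne_root he hz hends
          obtain ⟨⟨b', l, hl⟩, -⟩ := hX.2.2 t h2.1.2
          have hW : K.IsDitrail (e :: es') p (-α) t (-α) :=
            .cons e es' p z t _ c _ he.1 hpq h1 fun h => hnew (h3 e h).2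
          refine (hX.2.2 p hpX.1.2).2 hpX.2 ⟨b', _, hW.append (by rw [neg_neg]; exact hl.of_induce)
            fun f hf hfl => ?_⟩
          rcases List.mem_cons.1 hf with rfl | hf
          · exact he.2 (hl.edge_mem f hfl)
          · exact (h3 f hf).1 (hl.edge_mem f hfl)
  · rintro v ⟨hv, e, he, u, hu, b, hends⟩
    rw [Set.mem_singleton_iff] at hu
    rw [hu] at hends
    have hvG := (K.contract X s).ends_mem e he (v, b) (by simp [hends])
    refine ⟨hrad.2 v hvG, ?_⟩
    have hvX : v ∉ X := hvG.elim (fun h => h.2) fun h => absurd h hv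
    obtain ⟨p, hpq, hpX⟩ := C.exists_ends_of_ne_root he hv hends
    rcases sign_eq_or_eq_neg b α with rfl | rfl
    · refine hproj v hvX _ ?_
      -- Without a `-α`-ditrail to `r`, the vertex `v` could be added to the largest linear set.
      by_contra hv'
      exact hvX (mem_linearPart_of_edge hK.1.1 he.1 hpq hpX.1.2
        (fun _ => rfl) hv')
    · exact ⟨[e], .single he (by rw [hends, Sym2.eq_swap])⟩


/-! ### Decomposition of round radials -/

/-- The set `Y` contains `r`, and from each vertex of `Y` the root `r` can be reached inside `Y`
with sign `-α` there, starting with any sign (only with `α` from `r` itself). -/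
def IsStrongSet (K : BidirectedGraph V E) (α : Sign) (r : V) (Y : Set V) : Prop :=
  r ∈ Y ∧ Y ⊆ K.vertexSet ∧
    ∀ x ∈ Y, ∀ a, (x = r → a = α) → x ∈ (K.induce Y).reach r a (-α)

/-- The largest strong set. -/
def strongPart (K : BidirectedGraph V E) (α : Sign) (r : V) : Set V :=
  ⋃₀ {Y | K.IsStrongSet α r Y}

theorem isStrongSet_strongPart (hr : r ∈ K.vertexSet) :
    K.IsStrongSet α r (K.strongPart α r) := by
  refine ⟨⟨{r}, ⟨rfl, by simpa using hr, ?_⟩, rfl⟩, Set.sUnion_subset fun Y hY => hY.2.1, ?_⟩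
  · rintro x rfl a ha
    obtain rfl := ha rfl
    exact ⟨[], .nil x a ⟨hr, rfl⟩⟩
  · rintro x ⟨Y, hY, hx⟩ a ha
    obtain ⟨es, h⟩ := hY.2.2 x hx a ha
    exact ⟨es, h.induce_mono (Set.subset_sUnion_of_mem hY)⟩

/-- A strong set can be extended by an ear. -/
theorem IsStrongSet.exists_ear (hα : ∀ e ∈ K.edgeSet, (r, α) ∉ K.ends e) {X : Set V}
    (hX : K.IsStrongSet α r X) {e : E} {t v y : V} {a b c : Sign} {es : List E}
    (he : e ∈ K.edgeSet) (hends : K.ends e = s((t, a), (v, b))) (ht : t ∈ X)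
    (h : K.IsDitrail es v (-b) y c) (hy : y ∈ X) : ∃ Y, K.IsStrongSet α r Y ∧ v ∈ Y := by
  classical
  by_cases hvX : v ∈ X
  · exact ⟨X, hX, hvX⟩
  -- A shortest choice of `P` meets `X` only at its end. It need not avoid `e`, which may still be
  -- its last edge.
  obtain ⟨P, y, c, hP, hy, hmin⟩ : ∃ P y c, K.IsDitrail P v (-b) y c ∧ y ∈ X ∧
      ∀ P' y' c', K.IsDitrail P' v (-b) y' c' → y' ∈ X → P.length ≤ P'.length := by
    have hex : ∃ n, ∃ P y c, K.IsDitrail P v (-b) y c ∧ y ∈ X ∧ P.length = n :=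
      ⟨_, es, y, c, h, hy, rfl⟩
    obtain ⟨P, y, c, hP, hy, hn⟩ := Nat.find_spec hex
    exact ⟨P, y, c, hP, hy, fun P' y' c' h1 h2 =>
      hn ▸ Nat.find_min' hex ⟨P', y', c', h1, h2, rfl⟩⟩
  -- At `u = r` the arriving sign is `-α` by `hα`, so the continuation starts with `α`, the only
  -- sign guaranteed at the root.
  have hext : ∀ {u : V} {d : Sign} {f : E}, f ∈ K.edgeSet → (u, d) ∈ K.ends f → u ∈ X →
      ∃ l, (K.induce X).IsDitrail l u (-d) r (-α) := by
    intro u d f hf hu huX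
    refine hX.2.2 u huX (-d) ?_
    rintro rfl
    rcases sign_eq_or_eq_neg d α with rfl | rfl
    · exact absurd hu (hα f hf)
    · simp
  have hPX : ∀ f ∈ P, f ∉ (K.induce X).edgeSet := by
    intro f hf hfX
    obtain ⟨l₁, l₂, u, d, rfl, hu, h1, -⟩ := hP.exists_split_before hf
    have := hmin _ _ _ h1 (hfX.2 _ hu)
    simp at this
  have heX : e ∉ (K.induce X).edgeSet := fun h => hvX (h.2 (v, b) (by simp [hends]))
  have hPne : P ≠ [] := by
    rintro rfl
    exact hvX (hP.eq_of_nil.1 ▸ hy)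
  obtain ⟨fy, hfy, hyc⟩ := hP.exists_last_edge hPne
  obtain ⟨fv, hfv, hvb⟩ := hP.reverse.exists_last_edge (by simpa using hPne)
  rw [List.mem_reverse] at hfv
  obtain ⟨m, hm⟩ := hext (hP.edge_mem fy hfy) hyc hy
  obtain ⟨m', hm'⟩ := hext (u := t) (d := a) he (by simp [hends]) ht
  set Y : Set V := X ∪ {w | ∃ f ∈ P, ∃ p ∈ K.ends f, p.1 = w} with hYdef
  have hXY : X ⊆ Y := Set.subset_union_left
  have hPY : ∀ f ∈ P, ∀ p ∈ K.ends f, p.1 ∈ Y := fun f hf p hp => Or.inr ⟨f, hf, p, hp, rfl⟩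
  have hvY : v ∈ Y := hPY fv hfv _ hvb
  refine ⟨Y, ⟨hXY hX.1, ?_, ?_⟩, hvY⟩
  · rintro w (hw | ⟨f, hf, p, hp, rfl⟩)
    · exact hX.2.1 hw
    · exact K.ends_mem f (hP.edge_mem f hf) p hp
  · intro w hw σ hσ
    by_cases hwX : w ∈ X
    · obtain ⟨l, hl⟩ := hX.2.2 w hwX σ hσ
      exact ⟨l, hl.induce_mono hXY⟩
    · obtain ⟨f, hf, p, hp, rfl⟩ := hw.resolve_left hwX
      obtain ⟨l₁, l₂, d, rfl, h1, h2⟩ := hP.exists_split hf hp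
      have hl₂ : l₂ ≠ [] := by
        rintro rfl
        exact hwX (h2.eq_of_nil.1 ▸ hy)
      -- One sign at the ear vertex leads back along `P` and over `e` to `t`, the other forward
      -- along `P` to `y`; both then continue inside `X`.
      rcases sign_eq_or_eq_neg σ d with rfl | rfl
      -- If `e` occurred this early, cutting at its end `t` would give a shorter ditrail into `X`.
      · have hel : e ∉ l₁ := by
          intro hel
          obtain ⟨k₁, k₂, d', rfl, h3, -⟩ := h1.exists_split hel (p := (t, a)) (by simp [hends])
          have := hmin _ _ _ h3 ht
          have := List.length_pos_iff.2 hl₂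
          simp only [List.length_append] at *
          omega
        have h3 : K.IsDitrail (l₁.reverse ++ [e]) p.1 σ t a := by
          refine h1.reverse.append (.single he ?_) ?_
          · rw [neg_neg, hends, Sym2.eq_swap]
          · intro g hg hge
            rw [List.mem_singleton] at hge
            subst hge
            exact hel (by simpa using hg)
        refine ⟨_, (h3.to_induce hw ?_).append (hm'.induce_mono hXY) ?_⟩
        · intro g hg q hq
          rcases List.mem_append.1 hg with hg | hg
          · exact hPY g (by simp_all) q hq
          · rw [List.mem_singleton] at hg
            subst hg
            rw [hends, Sym2.mem_iff] at hq
            rcases hq with rfl | rfl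
            · exact hXY ht
            · exact hvY
        · intro g hg hgm
          rcases List.mem_append.1 hg with hg | hg
          · exact hPX g (by simp_all) (hm'.edge_mem g hgm)
          · rw [List.mem_singleton] at hg
            subst hg
            exact heX (hm'.edge_mem g hgm)
      · refine ⟨_, (h2.to_induce hw ?_).append (hm.induce_mono hXY) ?_⟩
        · intro g hg q hq
          exact hPY g (by simp [hg]) q hq
        · intro g hg hgm
          exact hPX g (by simp [hg]) (hm.edge_mem g hgm)

theorem mem_strongPart_of_ear (hr : r ∈ K.vertexSet) (hα : ∀ e ∈ K.edgeSet, (r, α) ∉ K.ends e)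
    {e : E} {t v y : V} {a b c : Sign} {es : List E} (he : e ∈ K.edgeSet)
    (hends : K.ends e = s((t, a), (v, b))) (ht : t ∈ K.strongPart α r)
    (h : K.IsDitrail es v (-b) y c) (hy : y ∈ K.strongPart α r) : v ∈ K.strongPart α r := by
  obtain ⟨Y, hY, hv⟩ := (isStrongSet_strongPart hr).exists_ear hα he hends ht h hy
  exact ⟨Y, hY, hv⟩

theorem IsStrongSet.isAlmostStrongRadial {X : Set V} (hX : K.IsStrongSet α r X)
    (hr : r ∉ K.reach r (-α) (-α)) : (K.induce X).IsAlmostStrongRadial α r := by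
  refine ⟨⟨⟨hX.2.1 hX.1, hX.1⟩, fun v hv => hX.2.2 v hv.2 α fun _ => rfl⟩,
    fun v hv hvr => hX.2.2 v hv.2 (-α) fun h => absurd h hvr, ?_⟩
  rintro ⟨es, h⟩
  exact hr ⟨es, h.of_induce⟩

/-- After the deletion every remaining edge at `r` has sign `-α` there, so roundness speaks about
all neighbors. By `IsRootEdgeExtension.reach_subset`, no vertex loses a ditrail arriving at `r` with
`-α`. -/
theorem IsRoundRadial.deleteRootEdges (hK : K.IsRoundRadial α r) :
    (K.deleteRootEdges α r).IsRoundRadial α r := by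
  have hext := K.isRootEdgeExtension_deleteRootEdges α r
  have hr : r ∉ (K.deleteRootEdges α r).reach r (-α) (-α) := fun h =>
    hK.2.1.2 (hext.subset_reach _ _ h)
  refine ⟨⟨hK.1.1, fun v hv => hext.reach_subset hr _ (hK.1.2 v hv)⟩,
    (isSublinearVertex_root_iff (G := K.deleteRootEdges α r) hK.1.1).2 hr, ?_⟩
  rintro v ⟨hv, e, he, h⟩
  have hs := hK.2.2 v ⟨hv, e, he.1, h⟩
  exact ⟨hext.reach_subset hr _ hs.1, hext.reach_subset hr _ hs.2⟩

theorem IsRoundRadial.mem_strongPart (hK : K.IsRoundRadial α r)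
    (hα : ∀ e ∈ K.edgeSet, (r, α) ∉ K.ends e) {e : E}
    (he : e ∈ K.edgeSet) (a : Sign) (v : V) (b : Sign) (h : K.ends e = s((r, a), (v, b))) :
    v ∈ K.strongPart α r := by
  have hrX := (isStrongSet_strongPart (α := α) hK.1.1).1
  by_cases hv : v = r
  · exact hv ▸ hrX
  · have ha : a = -α := (sign_eq_or_eq_neg a α).resolve_left <| by
      rintro rfl
      exact hα e he (by simp [h])
    subst ha
    have hst := hK.2.2 v ⟨hv, e, he, r, rfl, b, h⟩
    obtain ⟨es, hes⟩ : v ∈ K.reach r (-b) (-α) := by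
      rcases sign_eq_or_eq_neg b α with rfl | rfl
      · exact hst.2
      · rw [neg_neg]; exact hst.1
    exact mem_strongPart_of_ear hK.1.1 hα he h hrX hes hrX

theorem IsRoundRadial.isContraction (hK : K.IsRoundRadial α r)
    (hα : ∀ e ∈ K.edgeSet, (r, α) ∉ K.ends e) (hs : s ∉ K.vertexSet) :
    IsContraction K (K.contract (K.strongPart α r) s) s (K.induce (K.strongPart α r))
      ((K.induce (K.strongPart α r)).vertexSet \ {r}) id :=
  isContraction_contract hs (fun _ he => hK.mem_strongPart hα he)
    (isStrongSet_strongPart hK.1.1).1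

/-- Let an edge from `s` have sign `b` at `v`. A `-b`-ditrail from `v` to `s` would lift to an ear
of the largest strong set through `v`, so there is none. As `v` has an `α`-ditrail, `b = α`, and `v`
is linear. -/
theorem IsRoundRadial.isSharpSemiradial_contract (hK : K.IsRoundRadial α r)
    (hα : ∀ e ∈ K.edgeSet, (r, α) ∉ K.ends e) (hs : s ∉ K.vertexSet) :
    (K.contract (K.strongPart α r) s).IsSharpSemiradial α s := by
  have hX := isStrongSet_strongPart (α := α) hK.1.1
  have C := hK.isContraction hα hs
  set X := K.strongPart α r with hXdef
  have hsemi : (K.contract X s).IsSemiradial α s := by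
    refine ⟨C.root_mem, ?_⟩
    rintro v (hv | rfl)
    · obtain ⟨es, h⟩ := hK.1.2 v hv.1
      obtain ⟨es', t, c, -, h1, -⟩ := C.project h (fun h => hv.2 h.2) ⟨hK.1.1, hX.1⟩
      exact ⟨c, es', h1⟩
    · exact ⟨_, [], .nil v α C.root_mem⟩
  refine ⟨hsemi, loopsAt_contract C, ?_⟩
  rintro v ⟨a, hv, e, he, u, hu, b, hends⟩
  rw [Set.mem_singleton_iff] at hu
  rw [hu] at hends
  have hvG := (K.contract X s).ends_mem e he (v, b) (by simp [hends])
  have hvX : v ∉ X := hvG.elim (fun h => h.2) fun h => absurd h hv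
  obtain ⟨p, hpq, hpX⟩ := C.exists_ends_of_ne_root he hv hends
  have hnot : v ∉ (K.contract X s).reachAny s (-b) := by
    rintro ⟨c, es, h⟩
    obtain ⟨es', t, c', h1, h2, -⟩ := C.lift h hv
    exact hvX (mem_strongPart_of_ear hK.1.1 hα he.1 hpq hpX.1.2 h1 h2.1.2)
  have hb : b = α := by
    refine (sign_eq_or_eq_neg b α).resolve_right ?_
    rintro rfl
    rw [neg_neg] at hnot
    exact hnot (hsemi.2 v hvG)
  subst hb
  exact ⟨hsemi.2 v hvG, hnot⟩

/-! ### The families contain all round radials and sharp semiradials -/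

theorem isDitrail_induce_iff {X : Set V} (hX : K.vertexSet ⊆ X) {es : List E} {x y : V}
    {a b : Sign} :
    (K.induce X).IsDitrail es x a y b ↔ K.IsDitrail es x a y b :=
  ⟨fun h => h.of_induce, fun h => h.to_induce (hX h.left_mem) fun e he p hp =>
    hX (K.ends_mem e (h.edge_mem e he) p hp)⟩

theorem IsAlmostStrongRadial.of_induce {X : Set V} (hX : K.vertexSet ⊆ X)
    (h : (K.induce X).IsAlmostStrongRadial α r) : K.IsAlmostStrongRadial α r := by
  have hV : ∀ v ∈ K.vertexSet, v ∈ (K.induce X).vertexSet := fun v hv => ⟨hv, hX hv⟩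
  have hreach : ∀ a b, (K.induce X).reach r a b = K.reach r a b := by
    intro a b
    ext x
    exact exists_congr fun es => isDitrail_induce_iff hX
  simp only [IsAlmostStrongRadial, IsRadial, hreach] at h ⊢
  exact ⟨⟨h.1.1.1, fun v hv => h.1.2 v (hV v hv)⟩, fun v hv => h.2.1 v (hV v hv), h.2.2⟩

/-- Contraction exchanges round and sharp, so both claims share one induction. Infinitely many
vertex symbols are needed to find a fresh name for the contracted vertex. -/
theorem family_of_round_sharp [Infinite V] (n : ℕ) (α : Sign) :
    ∀ (r : V) (K : BidirectedGraph V E), K.vertexSet.ncard = n →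
      (K.IsRoundRadial α r → RoundFamily α r K) ∧ (K.IsSharpSemiradial α r → SharpFamily α r K) := by
  induction n using Nat.strong_induction_on with
  | _ n ih =>
    rintro r K rfl
    constructor
    · intro hK'
      refine .addEdges r _ K ?_ (K.isRootEdgeExtension_deleteRootEdges α r)
      have hK := hK'.deleteRootEdges
      have hα : ∀ e ∈ (K.deleteRootEdges α r).edgeSet, (r, α) ∉ (K.deleteRootEdges α r).ends e :=
        fun e he => he.2
      have hcard : (K.deleteRootEdges α r).vertexSet.ncard = K.vertexSet.ncard := rfl
      rw [← hcard] at ih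
      generalize K.deleteRootEdges α r = L at *
      have hX := isStrongSet_strongPart (α := α) hK.1.1
      have hH := hX.isAlmostStrongRadial hK.2.1.2
      by_cases hLX : L.vertexSet ⊆ L.strongPart α r
      · exact .base r L (hH.of_induce hLX)
      · obtain ⟨v, hvL, hvX⟩ := Set.not_subset.1 hLX
        obtain ⟨s, hs⟩ := L.finite_vertexSet.exists_notMem
        have C := hK.isContraction hα hs
        obtain ⟨es, h⟩ := hK.1.2 v hvL
        -- The entry point `t ≠ r` of a ditrail from outside shows that the contracted set has at
        -- least two vertices, so the vertex number drops.
        obtain ⟨-, t, -, -, -, -, ht, -⟩ := C.project h (fun h => hvX h.2) ⟨hK.1.1, hX.1⟩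
        have hlt := ncard_contract_lt (s := s) hX.2.1 ht.1.2 hX.1 ht.2
        exact .glue r s _ _ L ((ih _ hlt s _ rfl).2 (hK.isSharpSemiradial_contract hα hs)) hH
          C.isGluingSum
    · intro hK
      have hX := isLinearSet_linearPart (α := α) hK.1.1
      have hH := hX.isLinearSemiradial hK.2.1
      by_cases hKX : K.vertexSet ⊆ K.linearPart α r
      · exact .base r K ⟨hK.1, hK.2.1, fun es x b h =>
          hH.2.2 es x b ((isDitrail_induce_iff hKX).2 h)⟩
      · obtain ⟨v, hvK, hvX⟩ := Set.not_subset.1 hKX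
        obtain ⟨s, hs⟩ := K.finite_vertexSet.exists_notMem
        have C := hK.isContraction hs
        obtain ⟨b, es, h⟩ := hK.1.2 v hvK
        obtain ⟨-, t, -, -, -, -, ht, -⟩ := C.project h (fun h => hvX h.2) ⟨hK.1.1, hX.1⟩
        have hlt := ncard_contract_lt (s := s) hX.2.1 ht.1.2 hX.1 ht.2
        exact .glue r s _ _ K ((ih _ hlt s _ rfl).1 (hK.isRoundRadial_contract hs)) hH
          C.isGluingSum

end BidirectedGraph

theorem mainTheorem1 {V E : Type*} [Infinite V] (α : Sign) (r : V)
    (G : BidirectedGraph V E) :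
    (BidirectedGraph.RoundFamily α r G ↔ G.IsRoundRadial α r) ∧
    (BidirectedGraph.SharpFamily α r G ↔ G.IsSharpSemiradial α r) :=
  ⟨⟨fun h => h.isRoundRadial, (BidirectedGraph.family_of_round_sharp _ α r G rfl).1⟩,
    fun h => h.isSharpSemiradial, (BidirectedGraph.family_of_round_sharp _ α r G rfl).2⟩
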